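/- Let $M=(m_{ij})$ be a $2\times 2$ integer matrix with $\det M\neq 0$, and let $m=|\det M|$. Let $G(M;e_1,e_2)$ be the commutative $2$-step digraph of $M$: its vertices are the elements of the quotient group $\mathbb{Z}^2/M\mathbb{Z}^2$, where $M\mathbb{Z}^2$ is the lattice generated by the columns of $M$, and each vertex $u$ is adjacent exactly to the vertices $u+e_1$ and $u+e_2$, where $e_1=(1,0)^\top$ and $e_2=(0,1)^\top$ (taken modulo $M\mathbb{Z}^2$). A digraph is called a circulant digraph if it is isomorphic, for some positive integer $n$ and some subset $A\subseteq\mathbb{Z}/n\mathbb{Z}$, to the digraph with vertex set $\mathbb{Z}/n\mathbb{Z}$ in which each $u$ is adjacent exactly to the vertices $u+a$ with $a\in A$ (here $0\in A$, giving loops, is allowed). Then $G(M;e_1,e_2)$ is a circulant digraph if and only if either $$\gcd(m_{11},m_{12},m_{21},m_{22})=1,$$ or $$\gcd(m_{11},m_{12},m_{21},m_{22})=2\quad\text{and}\quad m=2\gcd(m,\;m_{22}+m_{12},\;m_{11}+m_{21}).$$ -/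

import Mathlib

/-- The Cayley digraph of an additive abelian group `Γ` with respect to a set `A` of steps:
vertex `u` is adjacent to exactly the vertices `u + a` with `a ∈ A`. -/
def cayleyDigraph (Γ : Type*) [AddCommGroup Γ] (A : Set Γ) : Digraph Γ where
  Adj u v := ∃ a ∈ A, v = u + a

/-- Two digraphs are isomorphic: there is a bijection of the vertices that preserves and reflects
adjacency. -/
def DigraphIsomorphic {V W : Type*} (G : Digraph V) (H : Digraph W) : Prop :=
  ∃ f : V ≃ W, ∀ u v : V, G.Adj u v ↔ H.Adj (f u) (f v)

/-- The circulant digraph `G(n; A)`: its vertices are the integers modulo `n`, and `u` is adjacent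
to the vertices `u + a`, `a ∈ A`. The step `0` (a loop at every vertex) is allowed. -/
def circulantDigraph (n : ℕ) (A : Set (ZMod n)) : Digraph (ZMod n) :=
  cayleyDigraph (ZMod n) A

/-- A digraph is a circulant digraph if it is isomorphic to `G(n; A)` for some positive integer `n`
and some set `A` of integers modulo `n`. -/
def IsCirculantDigraph {V : Type*} (G : Digraph V) : Prop :=
  ∃ n : ℕ, 0 < n ∧ ∃ A : Set (ZMod n), DigraphIsomorphic G (circulantDigraph n A)

/-- The lattice `M ℤⁿ` of the integral linear combinations of the columns of `M`. -/
def columnLattice {n : ℕ} (M : Matrix (Fin n) (Fin n) ℤ) : Submodule ℤ (Fin n → ℤ) :=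
  LinearMap.range M.mulVecLin

/-- The group `ℤⁿ / M ℤⁿ` of integral vectors modulo `M`. -/
abbrev VectorsMod {n : ℕ} (M : Matrix (Fin n) (Fin n) ℤ) : Type :=
  (Fin n → ℤ) ⧸ columnLattice M

/-- The class modulo `M` of the `i`-th unit vector. -/
def unitVectorMod {n : ℕ} (M : Matrix (Fin n) (Fin n) ℤ) (i : Fin n) : VectorsMod M :=
  (columnLattice M).mkQ (Pi.single i 1)

/-- The multidimensional circulant digraph `G(M; A)`: its vertices are the integral vectors modulo
`M`, and `u` is adjacent to the vertices `u + a`, `a ∈ A`. -/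
def multiCirculantDigraph {n : ℕ} (M : Matrix (Fin n) (Fin n) ℤ) (A : Set (VectorsMod M)) :
    Digraph (VectorsMod M) :=
  cayleyDigraph (VectorsMod M) A

/-- The commutative 2-step digraph `G(M; e₁, e₂)` of a `2 × 2` integer matrix `M`. -/
def commutativeTwoStepDigraph (M : Matrix (Fin 2) (Fin 2) ℤ) : Digraph (VectorsMod M) :=
  multiCirculantDigraph M {unitVectorMod M 0, unitVectorMod M 1}

/-- The first determinantal divisor of a `2 × 2` integer matrix: the greatest common divisor of its
four entries. -/
def entriesGcd (M : Matrix (Fin 2) (Fin 2) ℤ) : ℕ :=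
  Nat.gcd (Int.gcd (M 0 0) (M 0 1)) (Int.gcd (M 1 0) (M 1 1))

/-!
Let `a` and `b` generate an abelian group `Γ`. An isomorphism from the Cayley digraph of `{a, b}`
to another Cayley digraph, normalised to fix `0`, takes the two steps at every vertex to the same
two steps `c` and `d`, possibly interchanged. When `2a ≠ 2b` the interchange is constant along arcs,
so that the isomorphism is additive; a circulant digraph then forces `Γ` to be cyclic.
When `b - a` has order two, `{a, b}` is a coset of `⟨b - a⟩`, whose quotient is cyclic, and a Cayley
digraph on full fibres of a surjection `Γ → Q` depends only on `Q` and the size of the kernel, so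
`Γ` may be replaced by a cyclic group. Hence the digraph is circulant iff `Γ` is cyclic or `b - a`
has order two.

For `Γ = ℤ² / M ℤ²`, the adjugate describes membership in `M ℤ²` by divisibility by `det M`. This
gives `|det M| / gcd(mᵢⱼ)` for the exponent of `Γ`, to be compared with its order `|det M|`, and
`|det M| / gcd(det M, m₂₂ + m₁₂, m₁₁ + m₂₁)` for the order of `e₂ - e₁`, which is a multiple of
`gcd(mᵢⱼ)`.
-/

open scoped Matrix

section CayleyDigraph

variable {Γ Γ' : Type*} [AddCommGroup Γ] [AddCommGroup Γ']

theorem cayleyDigraph_preimage_adj {Q : Type*} [AddCommGroup Q] (p : Γ →+ Q) (B : Set Q)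
    (u v : Γ) : (cayleyDigraph Γ (p ⁻¹' B)).Adj u v ↔ (cayleyDigraph Q B).Adj (p u) (p v) := by
  constructor
  · rintro ⟨x, hx, rfl⟩
    exact ⟨p x, hx, map_add p u x⟩
  · rintro ⟨y, hy, huv⟩
    have hsub : p (v - u) = y := by rw [map_sub, huv, add_sub_cancel_left]
    exact ⟨v - u, by rwa [Set.mem_preimage, hsub], (add_sub_cancel u v).symm⟩

theorem digraphIsomorphic_cayleyDigraph_preimage {Q : Type*} [AddCommGroup Q]
    {p : Γ →+ Q} {p' : Γ' →+ Q} (hp : Function.Surjective p) (hp' : Function.Surjective p')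
    (e : p.ker ≃ p'.ker) (B : Set Q) :
    DigraphIsomorphic (cayleyDigraph Γ (p ⁻¹' B)) (cayleyDigraph Γ' (p' ⁻¹' B)) := by
  let fiberEquiv (c : Q) : {x // p x = c} ≃ {y // p' y = c} :=
    ((p.fiberEquivKerOfSurjective hp c).trans e).trans (p'.fiberEquivKerOfSurjective hp' c).symm
  refine ⟨Equiv.ofFiberEquiv fiberEquiv, fun u v => ?_⟩
  have hmap := Equiv.ofFiberEquiv_map fiberEquiv
  rw [cayleyDigraph_preimage_adj, cayleyDigraph_preimage_adj, hmap, hmap]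

theorem exists_surjective_zmod_of_natCard_dvd {Q : Type*} [AddCommGroup Q] [IsAddCyclic Q] {n : ℕ}
    (h : Nat.card Q ∣ n) : ∃ p : ZMod n →+ Q, Function.Surjective p := by
  let e : ZMod (Nat.card Q) ≃+ Q := zmodAddCyclicAddEquiv inferInstance
  exact ⟨e.toAddMonoidHom.comp (ZMod.castHom h (ZMod (Nat.card Q))).toAddMonoidHom,
    e.surjective.comp (ZMod.castHom_surjective h)⟩

theorem natCard_ker_mul_natCard {Q : Type*} [AddCommGroup Q] {p : Γ →+ Q}
    (hp : Function.Surjective p) : Nat.card p.ker * Nat.card Q = Nat.card Γ := by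
  rw [← p.ker.card_mul_index, AddSubgroup.index_ker, AddMonoidHom.range_eq_top.2 hp,
    AddSubgroup.card_top]

theorem isCirculantDigraph_cayleyDigraph_preimage [Finite Γ] {Q : Type*} [AddCommGroup Q]
    [IsAddCyclic Q] {p : Γ →+ Q} (hp : Function.Surjective p) (B : Set Q) :
    IsCirculantDigraph (cayleyDigraph Γ (p ⁻¹' B)) := by
  have : NeZero (Nat.card Γ) := ⟨Nat.card_pos.ne'⟩
  have : Finite Q := Finite.of_surjective p hp
  obtain ⟨p', hp'⟩ :=
    exists_surjective_zmod_of_natCard_dvd (AddSubgroup.card_dvd_of_surjective p hp)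
  have hker : Nat.card p.ker = Nat.card p'.ker := by
    apply Nat.eq_of_mul_eq_mul_right (Nat.card_pos (α := Q))
    rw [natCard_ker_mul_natCard hp, natCard_ker_mul_natCard hp', Nat.card_zmod]
  obtain ⟨e⟩ := Finite.card_eq.1 hker
  exact ⟨Nat.card Γ, Nat.card_pos, p' ⁻¹' B, digraphIsomorphic_cayleyDigraph_preimage hp hp' e B⟩

theorem DigraphIsomorphic.exists_equiv_map_zero {A : Set Γ} {B : Set Γ'}
    (h : DigraphIsomorphic (cayleyDigraph Γ A) (cayleyDigraph Γ' B)) :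
    ∃ f : Γ ≃ Γ', f 0 = 0 ∧
      ∀ u v, (cayleyDigraph Γ A).Adj u v ↔ (cayleyDigraph Γ' B).Adj (f u) (f v) := by
  obtain ⟨f, hf⟩ := h
  refine ⟨f.trans (Equiv.addRight (-f 0)), by simp, fun u v => (hf u v).trans ?_⟩
  simp only [cayleyDigraph, Equiv.trans_apply, Equiv.coe_addRight, add_right_comm _ (-f 0),
    add_left_inj]

theorem cayleyDigraph_zero_adj {A : Set Γ} {v : Γ} : (cayleyDigraph Γ A).Adj 0 v ↔ v ∈ A := by
  simp [cayleyDigraph]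

end CayleyDigraph

/-- At the vertex `u`, the map `f` takes the step `a` to the step `c` and the step `b` to the
step `d`. An isomorphism of Cayley digraphs with two steps does this at every vertex, up to an
interchange of `c` and `d` that may depend on the vertex. -/
def CarriesSteps {Γ Γ' : Type*} [Add Γ] [Add Γ'] (f : Γ → Γ') (a b : Γ) (c d : Γ') (u : Γ) :
    Prop :=
  f (u + a) = f u + c ∧ f (u + b) = f u + d

section Rigidity

variable {Γ Γ' : Type*} [AddCommGroup Γ] [AddCommGroup Γ'] {a b : Γ} {c d : Γ'} {f : Γ → Γ'}

theorem CarriesSteps.symm {u : Γ} (h : CarriesSteps f a b c d u) : CarriesSteps f b a d c u :=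
  ⟨h.2, h.1⟩

theorem map_add_add_eq_or_eq
    (hsteps : ∀ u, CarriesSteps f a b c d u ∨ CarriesSteps f a b d c u) (hcd : c + c = d + d)
    {x y : Γ} (hx : x = a ∨ x = b) (hy : y = a ∨ y = b) (u : Γ) :
    f (u + x + y) = f u + (c + c) ∨ f (u + x + y) = f u + (c + d) := by
  have map_step (w : Γ) {z : Γ} (hz : z = a ∨ z = b) :
      f (w + z) = f w + c ∨ f (w + z) = f w + d := by
    rcases hz with rfl | rfl <;> rcases hsteps w with h | h <;> simp [h.1, h.2]
  have hfirst := map_step u hx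
  have hsecond := map_step (u + x) hy
  grind

/-- If `2c = 2d`, then the three distinct ends of the walks of length two from `0` would be mapped
to only two vertices. -/
theorem add_self_ne_of_carriesSteps (hf : Function.Injective f)
    (hsteps : ∀ u, CarriesSteps f a b c d u ∨ CarriesSteps f a b d c u) (hab : a + a ≠ b + b) :
    c + c ≠ d + d := by
  intro hcd
  have hne : a ≠ b := by rintro rfl; exact hab rfl
  have haa := map_add_add_eq_or_eq hsteps hcd (.inl rfl) (.inl rfl) 0
  have h_ab := map_add_add_eq_or_eq hsteps hcd (.inl rfl) (.inr rfl) 0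
  have hbb := map_add_add_eq_or_eq hsteps hcd (.inr rfl) (.inr rfl) 0
  have haa_ab : f (0 + a + a) ≠ f (0 + a + b) := hf.ne (by simpa)
  have haa_bb : f (0 + a + a) ≠ f (0 + b + b) := hf.ne (by simpa)
  have hab_bb : f (0 + a + b) ≠ f (0 + b + b) := hf.ne (by simpa)
  grind

theorem CarriesSteps.step_left
    (hsteps : ∀ u, CarriesSteps f a b c d u ∨ CarriesSteps f a b d c u) (hcd : c + c ≠ d + d)
    {u : Γ} (h : CarriesSteps f a b c d u) : CarriesSteps f a b c d (u + a) := by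
  refine (hsteps (u + a)).resolve_right fun hswap => ?_
  have hab : f (u + b + a) = f u + (c + c) := by
    rw [add_right_comm, hswap.2, h.1, add_assoc]
  rcases hsteps (u + b) with h' | h' <;> rw [h'.1, h.2, add_assoc, add_right_inj] at hab
  · exact hcd (by rw [add_right_cancel hab])
  · exact hcd hab.symm

theorem CarriesSteps.step_right
    (hsteps : ∀ u, CarriesSteps f a b c d u ∨ CarriesSteps f a b d c u) (hcd : c + c ≠ d + d)
    {u : Γ} (h : CarriesSteps f a b c d u) : CarriesSteps f a b c d (u + b) :=
  (h.symm.step_left (fun w => (hsteps w).imp symm symm) hcd.symm).symm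

theorem carriesSteps_add_iff
    (hsteps : ∀ u, CarriesSteps f a b c d u ∨ CarriesSteps f a b d c u) (hcd : c + c ≠ d + d)
    {x : Γ} (hx : x = a ∨ x = b) (u : Γ) :
    CarriesSteps f a b c d (u + x) ↔ CarriesSteps f a b c d u := by
  have forward {c d : Γ'} (hsteps : ∀ u, CarriesSteps f a b c d u ∨ CarriesSteps f a b d c u)
      (hcd : c + c ≠ d + d) (h : CarriesSteps f a b c d u) : CarriesSteps f a b c d (u + x) := by
    rcases hx with rfl | rfl
    exacts [h.step_left hsteps hcd, h.step_right hsteps hcd]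
  refine ⟨fun h => (hsteps u).resolve_right fun hswap => ?_, forward hsteps hcd⟩
  have h' := forward (fun w => (hsteps w).symm) hcd.symm hswap
  exact hcd (by rw [add_left_cancel (h.1.symm.trans h'.1)])

theorem CarriesSteps.forall_of_zero (hgen : AddSubgroup.closure {a, b} = ⊤)
    (hsteps : ∀ u, CarriesSteps f a b c d u ∨ CarriesSteps f a b d c u) (hcd : c + c ≠ d + d)
    (h : CarriesSteps f a b c d 0) (u : Γ) : CarriesSteps f a b c d u := by
  suffices hperiod : ∀ w, CarriesSteps f a b c d (w + u) ↔ CarriesSteps f a b c d w by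
    simpa [h] using hperiod 0
  have hu : u ∈ AddSubgroup.closure {a, b} := hgen ▸ AddSubgroup.mem_top u
  induction hu using AddSubgroup.closure_induction with
  | mem x hx => exact carriesSteps_add_iff hsteps hcd hx
  | zero => simp
  | add x y _ _ hx hy => intro w; rw [← add_assoc, hy, hx]
  | neg x _ hx => intro w; rw [← hx, neg_add_cancel_right]

theorem map_add_of_carriesSteps (hgen : AddSubgroup.closure {a, b} = ⊤) (hf0 : f 0 = 0)
    (h : ∀ u, CarriesSteps f a b c d u) (u v : Γ) : f (u + v) = f u + f v := by
  suffices htranslate : ∃ t, ∀ w, f (w + v) = f w + t by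
    obtain ⟨t, ht⟩ := htranslate
    rw [ht, ← zero_add v, ht, hf0, zero_add]
  have hv : v ∈ AddSubgroup.closure {a, b} := hgen ▸ AddSubgroup.mem_top v
  induction hv using AddSubgroup.closure_induction with
  | mem x hx =>
    rcases hx with rfl | rfl
    exacts [⟨c, fun w => (h w).1⟩, ⟨d, fun w => (h w).2⟩]
  | zero => exact ⟨0, by simp⟩
  | add x y _ _ hx hy =>
    obtain ⟨s, hs⟩ := hx
    obtain ⟨t, ht⟩ := hy
    exact ⟨s + t, fun w => by rw [← add_assoc, ht, hs, add_assoc]⟩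
  | neg x _ hx =>
    obtain ⟨s, hs⟩ := hx
    exact ⟨-s, fun w => by
      rw [← sub_eq_add_neg (f w), eq_sub_iff_add_eq, ← hs, neg_add_cancel_right]⟩

theorem carriesSteps_or_swap_of_adj_iff {A : Set Γ'} {e : Γ ≃ Γ'} (he0 : e 0 = 0)
    (he : ∀ u v, (cayleyDigraph Γ {a, b}).Adj u v ↔ (cayleyDigraph Γ' A).Adj (e u) (e v)) (u : Γ) :
    CarriesSteps e a b (e a) (e b) u ∨ CarriesSteps e a b (e b) (e a) u := by
  have hA : A = {e a, e b} := by
    ext x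
    rw [← cayleyDigraph_zero_adj, ← he0, ← e.apply_symm_apply x, ← he, cayleyDigraph_zero_adj]
    simp [Equiv.symm_apply_eq]
  have map_step (x : Γ) (hx : x = a ∨ x = b) : e (u + x) = e u + e a ∨ e (u + x) = e u + e b := by
    simpa [cayleyDigraph, hA] using (he u (u + x)).1 ⟨x, hx, rfl⟩
  have hinj : e (u + a) = e (u + b) → e a = e b := fun h => by
    rw [add_left_cancel (e.injective h)]
  have ha := map_step a (.inl rfl)
  have hb := map_step b (.inr rfl)
  unfold CarriesSteps
  grind

theorem DigraphIsomorphic.nonempty_addEquiv {A : Set Γ'}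
    (h : DigraphIsomorphic (cayleyDigraph Γ {a, b}) (cayleyDigraph Γ' A))
    (hgen : AddSubgroup.closure {a, b} = ⊤) (hab : a + a ≠ b + b) : Nonempty (Γ ≃+ Γ') := by
  obtain ⟨e, he0, he⟩ := h.exists_equiv_map_zero
  have hsteps := carriesSteps_or_swap_of_adj_iff he0 he
  have hzero : CarriesSteps e a b (e a) (e b) 0 := by simp [CarriesSteps, he0]
  have hcarries :=
    hzero.forall_of_zero hgen hsteps (add_self_ne_of_carriesSteps e.injective hsteps hab)
  exact ⟨⟨e, map_add_of_carriesSteps hgen he0 hcarries⟩⟩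

end Rigidity

section TwoSteps

variable {Γ : Type*} [AddCommGroup Γ] {a b : Γ}

theorem isAddCyclic_of_map_eq {Q : Type*} [AddCommGroup Q] {p : Γ →+ Q}
    (hp : Function.Surjective p) (hgen : AddSubgroup.closure {a, b} = ⊤) (hab : p a = p b) :
    IsAddCyclic Q := by
  refine isAddCyclic_iff_exists_zmultiples_eq_top.2 ⟨p a, ?_⟩
  rw [← AddSubgroup.map_top_of_surjective p hp, ← hgen, AddMonoidHom.map_closure, Set.image_pair,
    ← hab, Set.pair_eq_singleton, AddSubgroup.zmultiples_eq_closure]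

theorem preimage_mk'_zmultiples_sub (hab : addOrderOf (b - a) = 2) :
    QuotientAddGroup.mk' (AddSubgroup.zmultiples (b - a)) ⁻¹' {↑a} = {a, b} := by
  classical
  ext x
  have hfin : IsOfFinAddOrder (b - a) := addOrderOf_pos_iff.1 (by omega)
  rw [Set.mem_preimage, Set.mem_singleton_iff, QuotientAddGroup.mk'_apply, eq_comm,
    QuotientAddGroup.eq, hfin.mem_zmultiples_iff_mem_range_addOrderOf, hab]
  simp [Finset.range_add_one, neg_add_eq_sub, sub_eq_zero, eq_comm, or_comm]

theorem isCirculantDigraph_cayleyDigraph_pair_iff [Finite Γ]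
    (hgen : AddSubgroup.closure {a, b} = ⊤) :
    IsCirculantDigraph (cayleyDigraph Γ {a, b}) ↔ IsAddCyclic Γ ∨ addOrderOf (b - a) = 2 := by
  constructor
  · rintro ⟨n, -, A, h⟩
    by_cases hab : a + a = b + b
    · have hdvd : addOrderOf (b - a) ∣ 2 := by
        rw [addOrderOf_dvd_iff_nsmul_eq_zero, nsmul_sub, two_nsmul, two_nsmul, hab, sub_self]
      refine ((Nat.dvd_prime Nat.prime_two).1 hdvd).imp_left fun hone => ?_
      rw [AddMonoid.addOrderOf_eq_one_iff, sub_eq_zero] at hone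
      exact isAddCyclic_of_map_eq (p := .id Γ) Function.surjective_id hgen hone.symm
    · obtain ⟨e⟩ := h.nonempty_addEquiv hgen hab
      exact .inl (e.isAddCyclic.2 inferInstance)
  · rintro (hcyc | hab)
    · exact isCirculantDigraph_cayleyDigraph_preimage (p := .id Γ) Function.surjective_id {a, b}
    · have hp := QuotientAddGroup.mk'_surjective (AddSubgroup.zmultiples (b - a))
      have hmap : (a : Γ ⧸ AddSubgroup.zmultiples (b - a)) = b :=
        QuotientAddGroup.eq.2 (by simp [neg_add_eq_sub])
      have := isAddCyclic_of_map_eq hp hgen hmap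
      rw [← preimage_mk'_zmultiples_sub hab]
      exact isCirculantDigraph_cayleyDigraph_preimage hp _

end TwoSteps

section ColumnLattice

variable {n : ℕ} {M : Matrix (Fin n) (Fin n) ℤ}

theorem mem_columnLattice_iff_det_dvd (hM : M.det ≠ 0) (v : Fin n → ℤ) :
    v ∈ columnLattice M ↔ ∀ i, M.det ∣ (M.adjugate *ᵥ v) i := by
  constructor
  · rintro ⟨w, rfl⟩ i
    rw [Matrix.mulVecLin_apply, Matrix.mulVec_mulVec, Matrix.adjugate_mul, Matrix.smul_mulVec,
      Matrix.one_mulVec]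
    exact dvd_mul_right _ _
  · intro h
    choose w hw using h
    have hw' : M.adjugate *ᵥ v = M.det • w := funext hw
    have hdet : M.det • (M *ᵥ w) = M.det • v := by
      rw [← Matrix.mulVec_smul, ← hw', Matrix.mulVec_mulVec, Matrix.mul_adjugate,
        Matrix.smul_mulVec, Matrix.one_mulVec]
    exact ⟨w, smul_right_injective _ hM hdet⟩

theorem nsmul_mkQ_columnLattice_eq_zero_iff (hM : M.det ≠ 0) (k : ℕ) (v : Fin n → ℤ) :
    k • (columnLattice M).mkQ v = 0 ↔ ∀ i, M.det ∣ k * (M.adjugate *ᵥ v) i := by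
  rw [← map_nsmul, Submodule.mkQ_apply, Submodule.Quotient.mk_eq_zero,
    mem_columnLattice_iff_det_dvd hM, Matrix.mulVec_smul]
  simp

theorem exponent_vectorsMod_dvd_iff (hM : M.det ≠ 0) (k : ℕ) :
    AddMonoid.exponent (VectorsMod M) ∣ k ↔ ∀ i j, M.det ∣ k * M.adjugate i j := by
  rw [AddMonoid.exponent_dvd_iff_forall_nsmul_eq_zero, (columnLattice M).mkQ_surjective.forall]
  simp only [nsmul_mkQ_columnLattice_eq_zero_iff hM]
  constructor
  · intro h i j
    simpa using h (Pi.single j 1) i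
  · intro h v i
    rw [Matrix.mulVec, dotProduct, Finset.mul_sum]
    exact Finset.dvd_sum fun j _ => mul_assoc (k : ℤ) _ (v j) ▸ (h i j).mul_right (v j)

theorem natCard_vectorsMod (hM : M.det ≠ 0) : Nat.card (VectorsMod M) = M.det.natAbs := by
  have hinj : Function.Injective M.mulVecLin := Matrix.mulVec_injective_of_det_ne_zero hM
  rw [← LinearMap.det_toLin', Matrix.toLin'_apply']
  exact (Submodule.natAbs_det_equiv (columnLattice M) (LinearEquiv.ofInjective _ hinj)).symm

theorem finite_vectorsMod (hM : M.det ≠ 0) : Finite (VectorsMod M) :=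
  Nat.finite_of_card_ne_zero (by rwa [natCard_vectorsMod hM, Int.natAbs_ne_zero])

theorem dvd_of_mem_columnLattice {c : ℤ} (hc : ∀ i j, c ∣ M i j) {v : Fin n → ℤ}
    (hv : v ∈ columnLattice M) (i : Fin n) : c ∣ v i := by
  obtain ⟨w, rfl⟩ := hv
  rw [Matrix.mulVecLin_apply, Matrix.mulVec, dotProduct]
  exact Finset.dvd_sum fun j _ => (hc i j).mul_right (w j)

theorem closure_range_unitVectorMod (M : Matrix (Fin n) (Fin n) ℤ) :
    AddSubgroup.closure (Set.range (unitVectorMod M)) = ⊤ := by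
  refine (AddSubgroup.eq_top_iff' _).2 fun x => ?_
  obtain ⟨v, rfl⟩ := (columnLattice M).mkQ_surjective x
  rw [pi_eq_sum_univ' v, map_sum]
  refine sum_mem fun i _ => ?_
  rw [map_smul]
  exact zsmul_mem (AddSubgroup.subset_closure (Set.mem_range_self i)) (v i)

end ColumnLattice

theorem mul_gcd_eq_of_forall_dvd_iff {o m g : ℕ} (h : ∀ k, o ∣ k ↔ m ∣ k * g) :
    o * Nat.gcd m g = m := by
  apply Nat.dvd_antisymm
  · have ho : o ∣ m / Nat.gcd m g := by
      rw [h, Nat.div_mul_right_comm (Nat.gcd_dvd_left m g),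
        Nat.mul_div_assoc _ (Nat.gcd_dvd_right m g)]
      exact dvd_mul_right _ _
    simpa [Nat.div_mul_cancel (Nat.gcd_dvd_left m g)] using Nat.mul_dvd_mul_right ho (Nat.gcd m g)
  · exact dvd_mul_gcd_of_dvd_mul ((h o).1 dvd_rfl)

section TwoByTwo

variable {M : Matrix (Fin 2) (Fin 2) ℤ}

theorem closure_pair_unitVectorMod (M : Matrix (Fin 2) (Fin 2) ℤ) :
    AddSubgroup.closure {unitVectorMod M 0, unitVectorMod M 1} = ⊤ := by
  rw [← closure_range_unitVectorMod M]
  congr 1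
  ext x
  simp [eq_comm]

theorem dvd_mul_entriesGcd_iff (M : Matrix (Fin 2) (Fin 2) ℤ) (a k : ℕ) :
    a ∣ k * entriesGcd M ↔ ∀ i j, (a : ℤ) ∣ k * M i j := by
  simp [entriesGcd, ← Nat.gcd_mul_left, Nat.dvd_gcd_iff, Int.natCast_dvd, Int.natAbs_mul, Int.gcd,
    Fin.forall_fin_two]

theorem entriesGcd_dvd (M : Matrix (Fin 2) (Fin 2) ℤ) (i j : Fin 2) :
    (entriesGcd M : ℤ) ∣ M i j := by
  simpa using (dvd_mul_entriesGcd_iff M (entriesGcd M) 1).1 (by simp) i j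

theorem exponent_vectorsMod_mul_entriesGcd (hM : M.det ≠ 0) :
    AddMonoid.exponent (VectorsMod M) * entriesGcd M = M.det.natAbs := by
  have hdvd : entriesGcd M ∣ M.det.natAbs := by
    rw [← Int.natCast_dvd, Matrix.det_fin_two]
    exact dvd_sub ((entriesGcd_dvd M 0 0).mul_right _) ((entriesGcd_dvd M 0 1).mul_right _)
  conv_lhs => rw [← Nat.gcd_eq_right hdvd]
  refine mul_gcd_eq_of_forall_dvd_iff fun k => ?_
  rw [exponent_vectorsMod_dvd_iff hM, dvd_mul_entriesGcd_iff, Matrix.adjugate_fin_two]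
  simp only [Fin.forall_fin_two, Int.natAbs_dvd, Matrix.of_apply, Matrix.cons_val_zero,
    Matrix.cons_val_one, mul_neg, dvd_neg]
  tauto

theorem isAddCyclic_vectorsMod_iff (hM : M.det ≠ 0) :
    IsAddCyclic (VectorsMod M) ↔ entriesGcd M = 1 := by
  have := finite_vectorsMod hM
  have hpos : 0 < M.det.natAbs := Int.natAbs_pos.2 hM
  rw [IsAddCyclic.iff_exponent_eq_card, natCard_vectorsMod hM]
  have hmul := exponent_vectorsMod_mul_entriesGcd hM
  constructor
  · intro h
    rw [h] at hmul
    exact (Nat.mul_eq_left hpos.ne').1 hmul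
  · intro h
    rwa [h, mul_one] at hmul

theorem addOrderOf_unitVectorMod_sub_mul_gcd (hM : M.det ≠ 0) :
    addOrderOf (unitVectorMod M 1 - unitVectorMod M 0) *
      Nat.gcd M.det.natAbs (Int.gcd (M 1 1 + M 0 1) (M 0 0 + M 1 0)) = M.det.natAbs := by
  have hadj : M.adjugate *ᵥ (Pi.single 1 1 - Pi.single 0 1) =
      ![-(M 1 1 + M 0 1), M 0 0 + M 1 0] := by
    ext i
    fin_cases i
    · simp [Matrix.adjugate_fin_two, sub_eq_add_neg, add_comm]
    · simp [Matrix.adjugate_fin_two, Matrix.mulVec_sub]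
  refine mul_gcd_eq_of_forall_dvd_iff fun k => ?_
  rw [addOrderOf_dvd_iff_nsmul_eq_zero, unitVectorMod, unitVectorMod, ← map_sub,
    nsmul_mkQ_columnLattice_eq_zero_iff hM, hadj, Int.gcd, ← Nat.gcd_mul_left, Nat.dvd_gcd_iff]
  simp only [Fin.forall_fin_two, Matrix.cons_val_zero, Matrix.cons_val_one,
    ← Int.natAbs_dvd_natAbs, Int.natAbs_mul, Int.natAbs_neg, Int.natAbs_natCast]

theorem entriesGcd_dvd_addOrderOf_unitVectorMod_sub (M : Matrix (Fin 2) (Fin 2) ℤ) :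
    entriesGcd M ∣ addOrderOf (unitVectorMod M 1 - unitVectorMod M 0) := by
  set k := addOrderOf (unitVectorMod M 1 - unitVectorMod M 0)
  have hmem : k • (Pi.single 1 1 - Pi.single 0 1 : Fin 2 → ℤ) ∈ columnLattice M := by
    rw [← Submodule.Quotient.mk_eq_zero, ← Submodule.mkQ_apply, map_nsmul, map_sub]
    exact addOrderOf_nsmul_eq_zero _
  simpa [Int.natCast_dvd_natCast] using dvd_of_mem_columnLattice (entriesGcd_dvd M) hmem 1

end TwoByTwo

theorem corollary3p6 (M : Matrix (Fin 2) (Fin 2) ℤ) (m : ℕ) (hM : M.det ≠ 0)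
    (hm : m = M.det.natAbs) :
    IsCirculantDigraph (commutativeTwoStepDigraph M) ↔
      entriesGcd M = 1 ∨
        (entriesGcd M = 2 ∧
          m = 2 * Nat.gcd m (Int.gcd (M 1 1 + M 0 1) (M 0 0 + M 1 0))) := by
  subst hm
  have := finite_vectorsMod hM
  have horder := addOrderOf_unitVectorMod_sub_mul_gcd hM
  have hdvd := entriesGcd_dvd_addOrderOf_unitVectorMod_sub M
  rw [commutativeTwoStepDigraph, multiCirculantDigraph,
    isCirculantDigraph_cayleyDigraph_pair_iff (closure_pair_unitVectorMod M),
    isAddCyclic_vectorsMod_iff hM]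
  set G := Nat.gcd M.det.natAbs (Int.gcd (M 1 1 + M 0 1) (M 0 0 + M 1 0))
  constructor
  · rintro (hone | htwo)
    · exact .inl hone
    · rw [htwo] at horder hdvd
      exact ((Nat.dvd_prime Nat.prime_two).1 hdvd).imp_right fun h => ⟨h, horder.symm⟩
  · rintro (hone | ⟨-, hdet⟩)
    · exact .inl hone
    · have hG : 0 < G := Nat.gcd_pos_of_pos_left _ (Int.natAbs_pos.2 hM)
      exact .inr (Nat.eq_of_mul_eq_mul_right hG (horder.trans hdet))
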